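/- Let $\tau\in\mathbb{C}$ with $\operatorname{Im}\tau>0$, and let $$\theta(u):=\sum_{\mu\in\frac12+\mathbb{Z}}\exp 2\pi i\Bigl(\mu\bigl(u+\tfrac12\bigr)+\frac{\mu^2}{2}\tau\Bigr)\qquad(u\in\mathbb{C})$$ be the odd Jacobi theta function. Put $Y_{r<s}:=1$ if $r<s$ and $Y_{r<s}:=0$ otherwise, and let $\delta_{r,s}$ be the Kronecker delta. Then for every integer $d\ge 1$ and all complex numbers $\hbar,u,\lambda_1,\dots,\lambda_d,\mu_1,\dots,\mu_d$, $$\det\left[\prod_{r=1}^d\theta\bigl(\mu_r-\lambda_{s'}+\hbar Y_{r<s}+\delta_{r,s}(u-(s-1)\hbar)\bigr)\right]_{s,s'=1,\dots,d} =\theta\Bigl(u+\sum_{r=1}^d(\mu_r-\lambda_r)\Bigr)\prod_{s=1}^{d-1}\theta(u-s\hbar)\prod_{1\le s<s'\le d}\theta(\lambda_{s'}-\lambda_s)\,\theta(\hbar+\mu_s-\mu_{s'}).$$ -/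

import Mathlib

/-- The theta series `θ_{m,l}(u,τ) = ∑_{μ ∈ m + lℤ} exp 2πi (μ u + μ² τ / (2l))`, with the
summation index written as `μ = m + l k`, `k ∈ ℤ` (a bijection onto `m + lℤ` for `l ≠ 0`). -/
noncomputable def thetaSeries (m l u τ : ℂ) : ℂ :=
  ∑' k : ℤ, Complex.exp (2 * Real.pi * Complex.I *
    ((m + l * k) * u + (m + l * k) ^ 2 / (2 * l) * τ))

/-- The odd Jacobi theta function `θ(u) = θ_{1/2,1}(u + 1/2, τ)`. -/
noncomputable def theta (τ u : ℂ) : ℂ :=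
  thetaSeries (1 / 2) 1 (u + 1 / 2) τ

/-- The matrix with entries
`∏_r θ(μ_r - λ_{s'} + ħ Y_{r<s} + δ_{r,s} (u - (s-1) ħ))`, where `Y_{r<s}` is `1` if `r < s` and
`0` otherwise. Indices in `Fin d` start at `0`, so that the number `s - 1` is `(s : ℂ)` here. -/
noncomputable def qFayMatrix (τ ħ u : ℂ) {d : ℕ} (lam mu : Fin d → ℂ) :
    Matrix (Fin d) (Fin d) ℂ :=
  Matrix.of fun s s' => ∏ r : Fin d,
    theta τ (mu r - lam s' + ħ * (if r < s then 1 else 0)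
      + (if r = s then 1 else 0) * (u - (s : ℕ) * ħ))

/-!
Both sides of the formula are antisymmetric in `lam` and, as functions of each single `lam i`,
theta functions of degree `d` with the same characteristic `u + ∑ r, mu r`. Fourier expansion shows
that such theta functions form a space of dimension at most `d`. An antisymmetric function whose
slices lie in a space of dimension at most `d` is determined by its value at one point `p` where
the alternant of `d` functions of that space does not vanish. At `p s = mu s` for `s ≠ 0`, with
`p 0` arbitrary, the matrix is triangular because `theta τ 0 = 0`, and its determinant is the
product side. If the product side vanishes at all these points, the parameters are first moved
along a line on which it does not, and continuity gives the formula.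
-/

open Complex Filter Topology

section Alternant

variable {ι X K : Type*} [Fintype ι] [DecidableEq ι] [Field K]

/-- A function of a tuple of points is antisymmetric if permuting the points multiplies it by the
sign of the permutation. Both sides of the determinant formula are antisymmetric in `lam`. -/
def IsAntisymmetric (G : (ι → X) → K) : Prop :=
  ∀ (σ : Equiv.Perm ι) (x : ι → X), G (x ∘ σ) = ((Equiv.Perm.sign σ : ℤ) : K) * G x

/-- The alternant of a family of functions: its matrix of values, with one row for each function
and one column for each point. The matrix `qFayMatrix` is an alternant in `lam`. -/
def alternantMatrix (g : ι → X → K) (x : ι → X) : Matrix ι ι K :=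
  Matrix.of fun s s' => g s (x s')

theorem isAntisymmetric_det_alternantMatrix (g : ι → X → K) :
    IsAntisymmetric fun x => (alternantMatrix g x).det :=
  fun σ x => Matrix.det_permute' σ (alternantMatrix g x)

theorem det_alternantMatrix_update_mem {V : Submodule K (X → K)} {g : ι → X → K}
    (hg : ∀ s, g s ∈ V) (x : ι → X) (i : ι) :
    (fun z => (alternantMatrix g (Function.update x i z)).det) ∈ V := by
  have hcramer : (fun z => (alternantMatrix g (Function.update x i z)).det) =
      ∑ s, (alternantMatrix g x).adjugate i s • g s := by
    funext z
    have hcol : alternantMatrix g (Function.update x i z) =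
        (alternantMatrix g x).updateCol i fun s => g s z := by
      ext s s'
      rcases eq_or_ne s' i with rfl | hs' <;> simp [alternantMatrix, *]
    rw [hcol, ← Matrix.cramer_apply, Matrix.cramer_eq_adjugate_mulVec, Matrix.mulVec_eq_sum,
      Finset.sum_apply, Finset.sum_apply]
    simp [mul_comm]
  rw [hcramer]
  exact Submodule.sum_mem _ fun s _ => V.smul_mem _ (hg s)

theorem eq_zero_of_det_alternantMatrix_ne_zero {V : Submodule K (X → K)} [FiniteDimensional K V]
    (hV : Module.finrank K V ≤ Fintype.card ι) {g : ι → X → K} (hg : ∀ s, g s ∈ V) {p : ι → X}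
    (hp : (alternantMatrix g p).det ≠ 0) {f : X → K} (hf : f ∈ V) (h0 : ∀ j, f (p j) = 0) :
    f = 0 := by
  have hli : LinearIndependent K fun s => (⟨g s, hg s⟩ : V) :=
    .of_comp (LinearMap.funLeft K K p ∘ₗ V.subtype)
      (Matrix.linearIndependent_rows_of_det_ne_zero hp)
  have hspan := hli.span_eq_top_of_card_eq_finrank' (hli.fintype_card_le_finrank.antisymm hV)
  obtain ⟨c, hc⟩ := (Submodule.mem_span_range_iff_exists_fun K).mp
    (hspan ▸ Submodule.mem_top : (⟨f, hf⟩ : V) ∈ _)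
  replace hc : ∑ s, c s • g s = f := by simpa using congrArg Subtype.val hc
  have hc0 : c = 0 := by
    refine Matrix.eq_zero_of_vecMul_eq_zero hp (funext fun j => ?_)
    simpa [Matrix.vecMul, dotProduct, alternantMatrix, ← hc] using h0 j
  simp [← hc, hc0]

theorem eq_zero_of_forall_apply_comp_eq_zero {ι κ : Type*} [Finite ι] [DecidableEq ι]
    {V : Submodule K (X → K)} {F : (ι → X) → K}
    (hF : ∀ x i, (fun z => F (Function.update x i z)) ∈ V) {p : κ → X}
    (hp : ∀ f ∈ V, (∀ j, f (p j) = 0) → f = 0) (h0 : ∀ φ : ι → κ, F (p ∘ φ) = 0) : F = 0 := by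
  cases nonempty_fintype ι
  suffices h : ∀ (S : Finset ι) (x : ι → X), (∀ i ∉ S, ∃ j, x i = p j) → F x = 0 from
    funext fun x => h Finset.univ x fun i hi => absurd (Finset.mem_univ i) hi
  intro S
  induction S using Finset.induction_on with
  | empty =>
    intro x hx
    choose φ hφ using fun i => hx i (Finset.notMem_empty i)
    exact (funext hφ : x = p ∘ φ) ▸ h0 φ
  | insert i S _ ih =>
    intro x hx
    have hslice := hp _ (hF x i) fun j => ih _ fun k hk => by
      rcases eq_or_ne k i with rfl | hki
      · exact ⟨j, Function.update_self ..⟩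
      · rw [Function.update_of_ne hki]
        exact hx k (by simp [hki, hk])
    simpa using congrFun hslice (x i)

namespace IsAntisymmetric

variable {G : (ι → X) → K}

theorem update_mem (hG : IsAntisymmetric G) {V : Submodule K (X → K)} {i₀ : ι}
    (h : ∀ x, (fun z => G (Function.update x i₀ z)) ∈ V) (x : ι → X) (i : ι) :
    (fun z => G (Function.update x i z)) ∈ V := by
  have hswap : (fun z => G (Function.update x i z)) =
      ((Equiv.Perm.sign (Equiv.swap i₀ i) : ℤ) : K) •
        fun z => G (Function.update (x ∘ Equiv.swap i₀ i) i₀ z) := by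
    funext z
    rw [Pi.smul_apply, smul_eq_mul, ← hG, Function.update_comp_equiv, Function.comp_assoc,
      Equiv.symm_swap, Equiv.swap_apply_left]
    simp [← Equiv.coe_trans]
  exact hswap ▸ V.smul_mem _ (h _)

theorem eq_zero_of_not_injective [NeZero (2 : K)] (hG : IsAntisymmetric G) {x : ι → X}
    (hx : ¬ Function.Injective x) : G x = 0 := by
  obtain ⟨i, j, hij, hne⟩ := Function.not_injective_iff.mp hx
  have hfix : x ∘ Equiv.swap i j = x := by simp [Equiv.comp_swap_eq_update, hij]
  have hneg : G x = -G x := by simpa [hfix, Equiv.Perm.sign_swap hne] using hG (Equiv.swap i j) x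
  have htwo : (2 : K) * G x = 0 := by linear_combination hneg
  exact (mul_eq_zero.mp htwo).resolve_left two_ne_zero

theorem apply_mul_det_alternantMatrix [NeZero (2 : K)] (hG : IsAntisymmetric G)
    {V : Submodule K (X → K)} [FiniteDimensional K V]
    (hV : Module.finrank K V ≤ Fintype.card ι) {i₀ : ι}
    (hGV : ∀ x, (fun z => G (Function.update x i₀ z)) ∈ V) {g : ι → X → K} (hg : ∀ s, g s ∈ V)
    {p : ι → X} (hp : (alternantMatrix g p).det ≠ 0) (x : ι → X) :
    G x * (alternantMatrix g p).det = G p * (alternantMatrix g x).det := by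
  let F : (ι → X) → K := fun x =>
    (alternantMatrix g p).det * G x - G p * (alternantMatrix g x).det
  have hF : IsAntisymmetric F := fun σ x => by
    simp only [F, hG σ x, isAntisymmetric_det_alternantMatrix g σ x]
    ring
  have hFV : ∀ x i, (fun z => F (Function.update x i z)) ∈ V := fun x i =>
    V.sub_mem (V.smul_mem _ (hG.update_mem hGV x i))
      (V.smul_mem _ (det_alternantMatrix_update_mem hg x i))
  have hFp : ∀ φ : ι → ι, F (p ∘ φ) = 0 := fun φ => by
    by_cases hφ : Function.Injective φ
    · have h := hF (Equiv.ofBijective φ (Finite.injective_iff_bijective.mp hφ)) p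
      simpa [F, mul_comm] using h
    · exact hF.eq_zero_of_not_injective fun h => hφ h.of_comp
  have hF0 : F = 0 := eq_zero_of_forall_apply_comp_eq_zero hFV
    (fun _ hf => eq_zero_of_det_alternantMatrix_ne_zero hV hg hp hf) hFp
  exact mul_comm (G x) _ ▸ sub_eq_zero.mp (congrFun hF0 x)

end IsAntisymmetric

end Alternant

section EntireFunctions

theorem eq_zero_of_forall_ofReal_eq_zero {f : ℂ → ℂ} (hf : Differentiable ℂ f)
    (h : ∀ x : ℝ, f x = 0) : f = 0 := by
  have hfreq : ∃ᶠ z in 𝓝[≠] ((0 : ℝ) : ℂ), f z = 0 :=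
    (hasDerivAt_id (0 : ℝ)).ofReal_comp.tendsto_nhdsNE one_ne_zero |>.frequently
      (Eventually.of_forall h).frequently
  exact AnalyticOnNhd.eq_of_frequently_eq (fun z _ => hf.analyticAt z)
    (fun _ _ => analyticAt_const) hfreq

theorem eventually_apply_add_mul_ne_zero {f : ℂ → ℂ} (hf : Differentiable ℂ f) (hf0 : f ≠ 0)
    (a : ℂ) {b : ℂ} (hb : b ≠ 0) : ∀ᶠ t in 𝓝[≠] (0 : ℂ), f (a + t * b) ≠ 0 := by
  have hline : HasDerivAt (fun t : ℂ => a + t * b) b 0 := by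
    simpa using ((hasDerivAt_id (0 : ℂ)).mul_const b).const_add a
  have hne : ∀ᶠ z in 𝓝[≠] (a + 0 * b), f z ≠ 0 := by
    by_contra hfreq
    simp only [not_eventually, not_not] at hfreq
    exact hf0 (AnalyticOnNhd.eq_of_frequently_eq (fun z _ => hf.analyticAt z)
      (fun _ _ => analyticAt_const) hfreq)
  exact (hline.tendsto_nhdsNE hb).eventually hne

theorem integral_add_mul_I_eq_of_periodic {h : ℂ → ℂ} (hd : Differentiable ℂ h)
    (hp : Function.Periodic h 1) (b : ℝ) :
    ∫ x in (0 : ℝ)..1, h (x + b * I) = ∫ x in (0 : ℝ)..1, h x := by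
  have hsides : ∀ y : ℝ, h (1 + y * I) = h (y * I) := fun y => by rw [add_comm, hp]
  have hrect : (∫ x in (0 : ℝ)..1, h x) - ∫ x in (0 : ℝ)..1, h (x + b * I) = 0 := by
    simpa [hsides] using integral_boundary_rect_eq_zero_of_differentiableOn h 0 (1 + b * I)
      hd.differentiableOn
  exact (sub_eq_zero.mp hrect).symm

theorem integral_add_eq_of_periodic {h : ℂ → ℂ} (hd : Differentiable ℂ h)
    (hp : Function.Periodic h 1) (w : ℂ) :
    ∫ x in (0 : ℝ)..1, h (x + w) = ∫ x in (0 : ℝ)..1, h x := by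
  have hper : Function.Periodic (fun x : ℝ => h (x + w.im * I)) 1 := fun x => by
    simpa [add_right_comm] using hp (x + w.im * I)
  calc ∫ x in (0 : ℝ)..1, h (x + w)
      = ∫ x in (0 : ℝ)..1, h ((x + w.re : ℝ) + w.im * I) := by
        simp only [ofReal_add, add_assoc, re_add_im]
    _ = ∫ x in w.re..w.re + 1, h (x + w.im * I) := by
        rw [intervalIntegral.integral_comp_add_right fun x : ℝ => h (x + w.im * I), zero_add,
          add_comm 1]
    _ = ∫ x in (0 : ℝ)..1, h (x + w.im * I) := by
        rw [hper.intervalIntegral_add_eq w.re 0, zero_add]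
    _ = ∫ x in (0 : ℝ)..1, h x := integral_add_mul_I_eq_of_periodic hd hp w.im

end EntireFunctions

section FourierCoefficients

/-- The `n`-th Fourier coefficient of a function of period `1`. The function lives on `ℂ`, so that
its translates by complex periods can be compared, but only its values on `[0, 1]` matter. -/
noncomputable def unitFourierCoeff (h : ℂ → ℂ) (n : ℤ) : ℂ :=
  ∫ x in (0 : ℝ)..1, h x * exp (-(2 * Real.pi * I * n * x))

theorem unitFourierCoeff_add {f g : ℂ → ℂ} (hf : Continuous f) (hg : Continuous g) (n : ℤ) :
    unitFourierCoeff (f + g) n = unitFourierCoeff f n + unitFourierCoeff g n := by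
  simp only [unitFourierCoeff, Pi.add_apply, add_mul]
  exact intervalIntegral.integral_add (Continuous.intervalIntegrable (by fun_prop) _ _)
    (Continuous.intervalIntegrable (by fun_prop) _ _)

theorem unitFourierCoeff_const_mul (c : ℂ) (f : ℂ → ℂ) (n : ℤ) :
    unitFourierCoeff (fun x => c * f x) n = c * unitFourierCoeff f n := by
  simp only [unitFourierCoeff, mul_assoc, intervalIntegral.integral_const_mul]

theorem unitFourierCoeff_comp_add_right {h : ℂ → ℂ} (hd : Differentiable ℂ h)
    (hp : Function.Periodic h 1) (w : ℂ) (n : ℤ) :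
    unitFourierCoeff (fun x => h (x + w)) n =
      exp (2 * Real.pi * I * n * w) * unitFourierCoeff h n := by
  have hper : Function.Periodic (fun x => h x * exp (-(2 * Real.pi * I * n * x))) 1 := fun x => by
    have hexp : exp (-(2 * Real.pi * I * n)) = 1 := by
      rw [exp_eq_one_iff]
      exact ⟨-n, by push_cast; ring⟩
    simp only [hp x, mul_add, neg_add, exp_add, mul_one, hexp]
  rw [unitFourierCoeff, unitFourierCoeff, ← integral_add_eq_of_periodic (by fun_prop) hper w,
    ← intervalIntegral.integral_const_mul]
  refine intervalIntegral.integral_congr fun x _ => ?_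
  rw [mul_left_comm, ← exp_add]
  ring_nf

theorem unitFourierCoeff_eq_zero_iff_add {h : ℂ → ℂ} (hd : Differentiable ℂ h)
    (hp : Function.Periodic h 1) {w c : ℂ} (hc : c ≠ 0) {k : ℤ}
    (hw : ∀ x, h (x + w) = c * (h x * exp (-(2 * Real.pi * I * k * x)))) (n : ℤ) :
    unitFourierCoeff h n = 0 ↔ unitFourierCoeff h (n + k) = 0 := by
  have hshift : unitFourierCoeff (fun x => h (x + w)) n = c * unitFourierCoeff h (n + k) := by
    simp only [hw, unitFourierCoeff_const_mul]
    congr 1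
    refine intervalIntegral.integral_congr fun x _ => ?_
    simp only [mul_assoc (h x), ← exp_add]
    push_cast
    ring_nf
  rw [← mul_eq_zero_iff_left (b := unitFourierCoeff h (n + k)) hc, ← hshift,
    unitFourierCoeff_comp_add_right hd hp, mul_eq_zero_iff_left (exp_ne_zero _)]

theorem eq_zero_of_forall_unitFourierCoeff_eq_zero {h : ℂ → ℂ} (hd : Differentiable ℂ h)
    (hp : Function.Periodic h 1) (h0 : ∀ n, unitFourierCoeff h n = 0) : h = 0 := by
  refine eq_zero_of_forall_ofReal_eq_zero hd fun x => ?_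
  have hpR : Function.Periodic (fun x : ℝ => h x) 1 := fun x => by simpa using hp x
  let H : C(UnitAddCircle, ℂ) :=
    ⟨hpR.lift, continuous_coinduced_dom.mpr (hd.continuous.comp continuous_ofReal)⟩
  have hcoeff : fourierCoeff H = 0 := by
    funext n
    rw [fourierCoeff_eq_intervalIntegral _ n 0, Pi.zero_apply]
    simp only [div_one, one_smul, zero_add, ← h0 n]
    refine intervalIntegral.integral_congr fun y _ => ?_
    simp only [H, fourier_coe_apply, smul_eq_mul, mul_comm (h y)]
    congr 2
    push_cast
    ring
  have hsum := has_pointwise_sum_fourier_series_of_summable (f := H)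
    (by rw [hcoeff]; exact summable_zero) (x : UnitAddCircle)
  simp only [hcoeff, Pi.zero_apply, zero_smul] at hsum
  exact hsum.unique hasSum_zero

theorem eq_zero_of_unitFourierCoeff_eq_zero {h : ℂ → ℂ} (hd : Differentiable ℂ h)
    (hp : Function.Periodic h 1) {w c : ℂ} (hc : c ≠ 0) {k : ℤ} (hk : 0 < k)
    (hw : ∀ x, h (x + w) = c * (h x * exp (-(2 * Real.pi * I * k * x))))
    (h0 : ∀ n, 0 ≤ n → n < k → unitFourierCoeff h n = 0) : h = 0 := by
  have hper : Function.Periodic (fun n => unitFourierCoeff h n = 0) k := fun n =>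
    propext (unitFourierCoeff_eq_zero_iff_add hd hp hc hw n).symm
  refine eq_zero_of_forall_unitFourierCoeff_eq_zero hd hp fun n => ?_
  have hmod : unitFourierCoeff h (n % k) = 0 ↔ unitFourierCoeff h n = 0 := by
    simpa [Int.emod_def, mul_comm k] using hper.sub_zsmul_eq (x := n) (n / k)
  exact hmod.mp (h0 _ (Int.emod_nonneg n hk.ne') (Int.emod_lt_of_pos n hk))

end FourierCoefficients

section Theta

theorem theta_eq_exp_mul_jacobiTheta₂ (τ u : ℂ) :
    theta τ u = exp (Real.pi * I * (u + 1 / 2 + τ / 4)) *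
      jacobiTheta₂ (u + 1 / 2 + τ / 2) τ := by
  rw [theta, thetaSeries, jacobiTheta₂, ← tsum_mul_left]
  refine tsum_congr fun k => ?_
  rw [jacobiTheta₂_term, ← exp_add]
  congr 1
  ring

theorem differentiable_theta {τ : ℂ} (hτ : 0 < τ.im) : Differentiable ℂ (theta τ) := by
  intro u
  have hjacobi := (differentiableAt_jacobiTheta₂_fst (u + 1 / 2 + τ / 2) hτ).comp u
    (f := fun u : ℂ => u + 1 / 2 + τ / 2) (by fun_prop)
  rw [funext (theta_eq_exp_mul_jacobiTheta₂ τ)]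
  exact DifferentiableAt.mul (by fun_prop) hjacobi

theorem antiperiodic_theta (τ : ℂ) : Function.Antiperiodic (theta τ) 1 := by
  intro u
  rw [theta_eq_exp_mul_jacobiTheta₂, theta_eq_exp_mul_jacobiTheta₂,
    show u + 1 + 1 / 2 + τ / 2 = (u + 1 / 2 + τ / 2) + 1 by ring, jacobiTheta₂_add_left,
    show Real.pi * I * (u + 1 + 1 / 2 + τ / 4) = Real.pi * I * (u + 1 / 2 + τ / 4) + Real.pi * I
      by ring, exp_add, exp_pi_mul_I]
  ring

theorem theta_sub_period (τ u : ℂ) :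
    theta τ (u - τ) = -exp (2 * Real.pi * I * u - Real.pi * I * τ) * theta τ u := by
  have hjacobi := jacobiTheta₂_add_left' (u - τ + 1 / 2 + τ / 2) τ
  rw [show u - τ + 1 / 2 + τ / 2 + τ = u + 1 / 2 + τ / 2 by ring] at hjacobi
  rw [theta_eq_exp_mul_jacobiTheta₂, theta_eq_exp_mul_jacobiTheta₂, hjacobi, ← mul_assoc,
    ← mul_assoc, ← neg_one_mul (exp _), ← exp_pi_mul_I, ← exp_add, ← exp_add, ← exp_add]
  congr 2
  ring

theorem theta_neg (τ u : ℂ) : theta τ (-u) = -theta τ u := by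
  have hone := jacobiTheta₂_add_left (-u - 1 / 2 - τ / 2) τ
  have hperiod := jacobiTheta₂_add_left' (-u + 1 / 2 - τ / 2) τ
  have hneg := jacobiTheta₂_neg_left (u + 1 / 2 + τ / 2) τ
  rw [show -u - 1 / 2 - τ / 2 + 1 = -u + 1 / 2 - τ / 2 by ring,
    show -u - 1 / 2 - τ / 2 = -(u + 1 / 2 + τ / 2) by ring, hneg] at hone
  rw [show -u + 1 / 2 - τ / 2 + τ = -u + 1 / 2 + τ / 2 by ring, hone] at hperiod
  rw [theta_eq_exp_mul_jacobiTheta₂, theta_eq_exp_mul_jacobiTheta₂, hperiod, ← mul_assoc,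
    ← exp_add, ← neg_mul, ← neg_one_mul (exp _), ← exp_pi_mul_I, ← exp_add]
  congr 1
  rw [exp_eq_exp_iff_exists_int]
  exact ⟨-1, by push_cast; ring⟩

theorem theta_zero (τ : ℂ) : theta τ 0 = 0 :=
  self_eq_neg.mp (by simpa using theta_neg τ 0)

theorem integral_jacobiTheta₂_term (n : ℤ) (τ : ℂ) :
    ∫ x in (0 : ℝ)..1, jacobiTheta₂_term n x τ = if n = 0 then 1 else 0 := by
  split_ifs with hn
  · simp [hn, jacobiTheta₂_term]
  · have hfreq : (2 * Real.pi * I * n : ℂ) ≠ 0 := by simp [Real.pi_ne_zero, hn]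
    have hone : exp (2 * Real.pi * I * n) = 1 := by
      rw [mul_comm, exp_int_mul_two_pi_mul_I]
    simp [jacobiTheta₂_term, exp_add, integral_exp_mul_complex hfreq, hone]

theorem integral_jacobiTheta₂ {τ : ℂ} (hτ : 0 < τ.im) :
    ∫ x in (0 : ℝ)..1, jacobiTheta₂ x τ = 1 := by
  let term (n : ℤ) : C(ℝ, ℂ) :=
    ⟨fun x => jacobiTheta₂_term n x τ, by unfold jacobiTheta₂_term; fun_prop⟩
  have hsummable : Summable fun n => ‖(term n).restrict
      (⟨Set.uIcc (0 : ℝ) 1, isCompact_uIcc⟩ : TopologicalSpace.Compacts ℝ)‖ := by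
    refine ((summable_jacobiTheta₂_term_iff 0 τ).mpr hτ).norm.of_nonneg_of_le
      (fun _ => norm_nonneg _) fun n => (ContinuousMap.norm_le _ (norm_nonneg _)).mpr fun x => ?_
    simp [term, norm_jacobiTheta₂_term]
  have hsum := intervalIntegral.hasSum_intervalIntegral_of_summable_norm hsummable
  simp only [term, ContinuousMap.coe_mk, integral_jacobiTheta₂_term] at hsum
  exact hsum.unique (hasSum_ite_eq 0 1)

theorem theta_ne_zero {τ : ℂ} (hτ : 0 < τ.im) : theta τ ≠ 0 := by
  intro h
  have hjacobi : ∀ z, jacobiTheta₂ z τ = 0 := fun z => by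
    have hz := theta_eq_exp_mul_jacobiTheta₂ τ (z - 1 / 2 - τ / 2)
    rw [h, show z - 1 / 2 - τ / 2 + 1 / 2 + τ / 2 = z by ring] at hz
    exact (mul_eq_zero.mp hz.symm).resolve_left (exp_ne_zero _)
  simpa [hjacobi] using integral_jacobiTheta₂ hτ

theorem eventually_theta_add_mul_ne_zero {τ : ℂ} (hτ : 0 < τ.im) (a : ℂ) {b : ℂ} (hb : b ≠ 0) :
    ∀ᶠ t in 𝓝[≠] (0 : ℂ), theta τ (a + t * b) ≠ 0 :=
  eventually_apply_add_mul_ne_zero (differentiable_theta hτ) (theta_ne_zero hτ) a hb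

end Theta

section ThetaSpace

/-- Theta functions of degree `d` and characteristic `A`: the entire functions with the
multipliers of `x ↦ ∏ r, theta τ (a r - x)`, where `r` runs over `d` indices and `∑ r, a r = A`. -/
noncomputable def thetaSpace (τ : ℂ) (d : ℕ) (A : ℂ) : Submodule ℂ (ℂ → ℂ) where
  carrier := {f | Differentiable ℂ f ∧ (∀ x, f (x + 1) = (-1) ^ d * f x) ∧
    ∀ x, f (x + τ) =
      (-1) ^ d * exp (2 * Real.pi * I * (A - d * x) - Real.pi * I * d * τ) * f x}
  add_mem' := by
    rintro f g ⟨hf, hf1, hfτ⟩ ⟨hg, hg1, hgτ⟩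
    refine ⟨hf.add hg, fun x => ?_, fun x => ?_⟩
    · rw [Pi.add_apply, hf1, hg1, Pi.add_apply, mul_add]
    · rw [Pi.add_apply, hfτ, hgτ, Pi.add_apply, mul_add]
  zero_mem' := ⟨differentiable_const 0, by simp, by simp⟩
  smul_mem' := by
    rintro c f ⟨hf, hf1, hfτ⟩
    refine ⟨hf.const_smul c, fun x => ?_, fun x => ?_⟩
    · rw [Pi.smul_apply, hf1, Pi.smul_apply, mul_smul_comm]
    · rw [Pi.smul_apply, hfτ, Pi.smul_apply, mul_smul_comm]

theorem prod_theta_sub_mem_thetaSpace {τ : ℂ} (hτ : 0 < τ.im) {d : ℕ} (a : Fin d → ℂ) :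
    (fun x => ∏ r, theta τ (a r - x)) ∈ thetaSpace τ d (∑ r, a r) := by
  refine ⟨?_, fun x => ?_, fun x => ?_⟩
  · have hfactor : ∀ r, Differentiable ℂ fun x => theta τ (a r - x) := fun r =>
      (differentiable_theta hτ).comp (by fun_prop)
    fun_prop
  · simp only [← sub_sub, (antiperiodic_theta τ).sub_eq, Finset.prod_neg, Finset.card_univ,
      Fintype.card_fin]
  · simp only [← sub_sub, theta_sub_period, Finset.prod_mul_distrib, Finset.prod_neg,
      Finset.card_univ, Fintype.card_fin, ← exp_sum]
    congr 3
    simp only [Finset.sum_sub_distrib, ← Finset.mul_sum, Finset.sum_const, Finset.card_univ,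
      Fintype.card_fin, nsmul_eq_mul]
    ring

/-- A theta function of degree `d` multiplied by `exp (π i d x)`, which turns its multiplier
`(-1) ^ d` along `1` into genuine periodicity. -/
noncomputable def thetaPeriodization (d : ℕ) (f : ℂ → ℂ) : ℂ → ℂ :=
  fun x => f x * exp (Real.pi * I * d * x)

theorem differentiable_thetaPeriodization (d : ℕ) {f : ℂ → ℂ} (hf : Differentiable ℂ f) :
    Differentiable ℂ (thetaPeriodization d f) := by
  unfold thetaPeriodization
  fun_prop

theorem periodic_thetaPeriodization {τ A : ℂ} {d : ℕ} {f : ℂ → ℂ} (hf : f ∈ thetaSpace τ d A) :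
    Function.Periodic (thetaPeriodization d f) 1 := by
  intro x
  have hexp : exp (Real.pi * I * d) = (-1) ^ d := by rw [mul_comm, exp_nat_mul, exp_pi_mul_I]
  have hsign : (-1 : ℂ) ^ d * (-1) ^ d = 1 := by rw [← mul_pow]; simp
  simp only [thetaPeriodization, hf.2.1, mul_add, mul_one, exp_add, hexp]
  linear_combination (f x * exp (Real.pi * I * d * x)) * hsign

theorem thetaPeriodization_add_period {τ A : ℂ} {d : ℕ} {f : ℂ → ℂ} (hf : f ∈ thetaSpace τ d A)
    (x : ℂ) : thetaPeriodization d f (x + τ) = (-1) ^ d * exp (2 * Real.pi * I * A) *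
      (thetaPeriodization d f x * exp (-(2 * Real.pi * I * (d : ℤ) * x))) := by
  have hexp : exp (2 * Real.pi * I * (A - d * x) - Real.pi * I * d * τ) *
      exp (Real.pi * I * d * (x + τ)) = exp (2 * Real.pi * I * A) *
        (exp (Real.pi * I * d * x) * exp (-(2 * Real.pi * I * (d : ℤ) * x))) := by
    simp only [← exp_add]
    push_cast
    ring_nf
  rw [thetaPeriodization, thetaPeriodization, hf.2.2]
  linear_combination ((-1) ^ d * f x) * hexp

/-- The Fourier coefficients with index `0, …, d - 1` of the periodization of a theta function of
degree `d`. The multiplier along `τ` determines all other Fourier coefficients from these. -/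
noncomputable def thetaCoeff (τ : ℂ) (d : ℕ) (A : ℂ) : thetaSpace τ d A →ₗ[ℂ] (Fin d → ℂ) where
  toFun f i := unitFourierCoeff (thetaPeriodization d f) (i : ℕ)
  map_add' f g := by
    funext i
    rw [Pi.add_apply, ← unitFourierCoeff_add
      (differentiable_thetaPeriodization d f.2.1).continuous
      (differentiable_thetaPeriodization d g.2.1).continuous]
    congr 1
    funext x
    simp only [thetaPeriodization, Submodule.coe_add, Pi.add_apply, add_mul]
  map_smul' c f := by
    funext i
    rw [Pi.smul_apply, smul_eq_mul, RingHom.id_apply, ← unitFourierCoeff_const_mul]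
    congr 1
    funext x
    simp only [thetaPeriodization, Submodule.coe_smul, Pi.smul_apply, smul_eq_mul, mul_assoc]

theorem thetaCoeff_injective (τ A : ℂ) {d : ℕ} (hd : 0 < d) :
    Function.Injective (thetaCoeff τ d A) := by
  refine (injective_iff_map_eq_zero _).mpr fun f hf => Subtype.ext (funext fun x => ?_)
  have hzero : thetaPeriodization d f = 0 :=
    eq_zero_of_unitFourierCoeff_eq_zero (differentiable_thetaPeriodization d f.2.1)
      (periodic_thetaPeriodization f.2) (by simp [exp_ne_zero]) (Int.natCast_pos.mpr hd)
      (thetaPeriodization_add_period f.2) fun n hn hnd => by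
        lift n to ℕ using hn
        exact congrFun hf ⟨n, Int.ofNat_lt.mp hnd⟩
  exact (mul_eq_zero.mp (congrFun hzero x)).resolve_right (exp_ne_zero _)

theorem finiteDimensional_thetaSpace (τ A : ℂ) {d : ℕ} (hd : 0 < d) :
    FiniteDimensional ℂ (thetaSpace τ d A) :=
  .of_injective _ (thetaCoeff_injective τ A hd)

theorem finrank_thetaSpace_le (τ A : ℂ) {d : ℕ} (hd : 0 < d) :
    Module.finrank ℂ (thetaSpace τ d A) ≤ d := by
  simpa using LinearMap.finrank_le_finrank_of_injective (thetaCoeff_injective τ A hd)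

end ThetaSpace

section QFay

variable (τ ħ u : ℂ)

/-- The factor with index `r` of the entries in row `s` of `qFayMatrix`, as a function of the
column variable. -/
noncomputable def qFayFactor {d : ℕ} (mu : Fin d → ℂ) (s r : Fin d) (x : ℂ) : ℂ :=
  theta τ (mu r - x + ħ * (if r < s then 1 else 0)
    + (if r = s then 1 else 0) * (u - (s : ℕ) * ħ))

/-- The entries of `qFayMatrix` in row `s`, as a function of the column variable. -/
noncomputable def qFayRow {d : ℕ} (mu : Fin d → ℂ) (s : Fin d) (x : ℂ) : ℂ :=
  ∏ r, qFayFactor τ ħ u mu s r x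

/-- The product side of the determinant formula. -/
noncomputable def qFayProduct {d : ℕ} (lam mu : Fin d → ℂ) : ℂ :=
  theta τ (u + ∑ r, (mu r - lam r)) *
    (∏ s ∈ Finset.Icc 1 (d - 1), theta τ (u - (s : ℂ) * ħ)) *
    ∏ s, ∏ s' ∈ Finset.Ioi s, (theta τ (lam s' - lam s) * theta τ (ħ + mu s - mu s'))

theorem qFayMatrix_eq_alternantMatrix {d : ℕ} (lam mu : Fin d → ℂ) :
    qFayMatrix τ ħ u lam mu = alternantMatrix (qFayRow τ ħ u mu) lam :=
  rfl

theorem qFayFactor_self {d : ℕ} (mu : Fin d → ℂ) (s : Fin d) (x : ℂ) :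
    qFayFactor τ ħ u mu s s x = theta τ (mu s - x + (u - (s : ℕ) * ħ)) := by
  simp [qFayFactor]

theorem qFayFactor_of_lt {d : ℕ} (mu : Fin d → ℂ) {s r : Fin d} (h : r < s) (x : ℂ) :
    qFayFactor τ ħ u mu s r x = theta τ (mu r - x + ħ) := by
  simp [qFayFactor, h, h.ne]

theorem qFayFactor_of_gt {d : ℕ} (mu : Fin d → ℂ) {s r : Fin d} (h : s < r) (x : ℂ) :
    qFayFactor τ ħ u mu s r x = theta τ (mu r - x) := by
  simp [qFayFactor, h.not_gt, h.ne']

theorem isAntisymmetric_qFayProduct {d : ℕ} (mu : Fin d → ℂ) :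
    IsAntisymmetric fun lam => qFayProduct τ ħ u lam mu := by
  intro σ lam
  have hsign := σ.prod_Ioi_comp_eq_sign_mul_prod (f := fun i j => theta τ (lam j - lam i))
    fun i j => by rw [← theta_neg, neg_sub]
  simp only [qFayProduct, Finset.prod_mul_distrib, Function.comp_apply, hsign,
    Finset.sum_sub_distrib, Equiv.sum_comp σ lam]
  ring

section Triangular

variable {n : ℕ} {lam mu : Fin (n + 1) → ℂ} (h : ∀ s ≠ 0, lam s = mu s)

include h

theorem isLowerTriangular_qFayMatrix : (qFayMatrix τ ħ u lam mu).IsLowerTriangular := by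
  intro s s' (hlt : s < s')
  refine Finset.prod_eq_zero (Finset.mem_univ s') ?_
  change qFayFactor τ ħ u mu s s' (lam s') = 0
  rw [qFayFactor_of_gt τ ħ u mu hlt, h s' (Fin.ne_zero_of_lt hlt), sub_self, theta_zero]

theorem prod_qFayFactor_self :
    ∏ s, qFayFactor τ ħ u mu s s (lam s) = theta τ (u + ∑ r, (mu r - lam r)) *
      ∏ s ∈ Finset.Icc 1 n, theta τ (u - (s : ℂ) * ħ) := by
  have hIcc : ∏ s ∈ Finset.Icc 1 n, theta τ (u - (s : ℂ) * ħ) =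
      ∏ j : Fin n, theta τ (u - ((j.succ : Fin (n + 1)) : ℕ) * ħ) := by
    simp only [Fin.val_succ]
    rw [Fin.prod_univ_eq_prod_range fun j => theta τ (u - ((j + 1 : ℕ) : ℂ) * ħ),
      Finset.range_eq_Ico, Finset.prod_Ico_add' fun s : ℕ => theta τ (u - (s : ℂ) * ħ)]
    rfl
  simp only [hIcc, Fin.prod_univ_succ, Fin.sum_univ_succ, qFayFactor_self, Fin.val_zero,
    h _ (Fin.succ_ne_zero _), sub_self, Finset.sum_const_zero, add_zero, zero_add,
    Nat.cast_zero, zero_mul, sub_zero, add_comm u]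

theorem prod_qFayFactor_compl :
    ∏ s, ∏ r ∈ {s}ᶜ, qFayFactor τ ħ u mu s r (lam s) =
      ∏ s, ∏ s' ∈ Finset.Ioi s, (theta τ (lam s' - lam s) * theta τ (ħ + mu s - mu s')) := by
  rw [← Finset.prod_prod_Ioi_mul_eq_prod_prod_off_diag fun r s => qFayFactor τ ħ u mu s r (lam s)]
  refine Finset.prod_congr rfl fun s _ => Finset.prod_congr rfl fun s' hs' => ?_
  have hlt : s < s' := Finset.mem_Ioi.mp hs'
  rw [qFayFactor_of_gt τ ħ u mu hlt, qFayFactor_of_lt τ ħ u mu hlt,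
    h s' (Fin.ne_zero_of_lt hlt)]
  ring_nf

theorem det_qFayMatrix_of_forall_ne_zero_eq :
    (qFayMatrix τ ħ u lam mu).det = qFayProduct τ ħ u lam mu := by
  calc (qFayMatrix τ ħ u lam mu).det
      = ∏ s, qFayRow τ ħ u mu s (lam s) :=
        Matrix.det_of_isLowerTriangular _ (isLowerTriangular_qFayMatrix τ ħ u h)
    _ = (∏ s, qFayFactor τ ħ u mu s s (lam s)) *
          ∏ s, ∏ r ∈ {s}ᶜ, qFayFactor τ ħ u mu s r (lam s) := by
        rw [← Finset.prod_mul_distrib]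
        exact Finset.prod_congr rfl fun s _ => Fintype.prod_eq_mul_prod_compl s _
    _ = qFayProduct τ ħ u lam mu := by
        rw [prod_qFayFactor_self τ ħ u h, prod_qFayFactor_compl τ ħ u h, qFayProduct,
          add_tsub_cancel_right]

end Triangular

variable {τ}

theorem qFayRow_mem_thetaSpace (hτ : 0 < τ.im) {d : ℕ} (mu : Fin d → ℂ) (s : Fin d) :
    qFayRow τ ħ u mu s ∈ thetaSpace τ d (u + ∑ r, mu r) := by
  have hcard : ∑ r : Fin d, (if r < s then (1 : ℂ) else 0) = (s : ℕ) := by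
    rw [Finset.sum_boole, Finset.filter_gt_eq_Iio, Fin.card_Iio]
  have hsum : ∑ r, (mu r + ħ * (if r < s then 1 else 0)
      + (if r = s then 1 else 0) * (u - (s : ℕ) * ħ)) = u + ∑ r, mu r := by
    simp only [Finset.sum_add_distrib, ← Finset.mul_sum, ← Finset.sum_mul, hcard,
      Finset.sum_ite_eq', Finset.mem_univ, if_true]
    ring
  rw [← hsum]
  convert prod_theta_sub_mem_thetaSpace hτ _ using 1
  funext x
  refine Finset.prod_congr rfl fun r _ => ?_
  rw [qFayFactor]
  ring_nf

theorem qFayProduct_update_zero_mem_thetaSpace (hτ : 0 < τ.im) {n : ℕ}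
    (lam mu : Fin (n + 1) → ℂ) :
    (fun z => qFayProduct τ ħ u (Function.update lam 0 z) mu) ∈
      thetaSpace τ (n + 1) (u + ∑ r, mu r) := by
  let a : Fin (n + 1) → ℂ := Fin.cons (u + ∑ r, mu r - ∑ j, Fin.tail lam j) (Fin.tail lam)
  let c : ℂ := (∏ s ∈ Finset.Icc 1 n, theta τ (u - (s : ℂ) * ħ)) *
    (∏ s, ∏ s' ∈ Finset.Ioi s, theta τ (ħ + mu s - mu s')) *
      ∏ s, ∏ s' ∈ Finset.Ioi s, theta τ (Fin.tail lam s' - Fin.tail lam s)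
  have ha : ∑ r, a r = u + ∑ r, mu r := by simp [a, Fin.sum_univ_succ]
  have hslice : (fun z => qFayProduct τ ħ u (Function.update lam 0 z) mu) =
      c • fun z => ∏ r, theta τ (a r - z) := by
    funext z
    have hhead : u + (∑ r, mu r - (z + ∑ j : Fin n, lam j.succ)) = a 0 - z := by
      simp only [a, Fin.cons_zero, Fin.tail]
      ring
    simp only [qFayProduct, Finset.prod_mul_distrib, Finset.sum_sub_distrib,
      add_tsub_cancel_right, Pi.smul_apply, smul_eq_mul]
    rw [Fin.sum_univ_succ (Function.update lam 0 z), Fin.prod_univ_succ fun s => ∏ s' ∈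
      Finset.Ioi s, theta τ (Function.update lam 0 z s' - Function.update lam 0 z s),
      Fin.prod_univ_succ fun r => theta τ (a r - z)]
    simp only [Fin.prod_Ioi_zero, Fin.prod_Ioi_succ, Function.update_self,
      Function.update_of_ne (Fin.succ_ne_zero _), hhead]
    simp only [a, c, Fin.cons_succ, Fin.tail]
    ring
  exact hslice ▸ ha ▸ Submodule.smul_mem _ c (prod_theta_sub_mem_thetaSpace hτ a)

theorem det_qFayMatrix_eq_qFayProduct_of_ne_zero (hτ : 0 < τ.im) {n : ℕ}
    (lam : Fin (n + 1) → ℂ) {mu : Fin (n + 1) → ℂ} {z : ℂ}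
    (hz : qFayProduct τ ħ u (Function.update mu 0 z) mu ≠ 0) :
    (qFayMatrix τ ħ u lam mu).det = qFayProduct τ ħ u lam mu := by
  have hp : (alternantMatrix (qFayRow τ ħ u mu) (Function.update mu 0 z)).det =
      qFayProduct τ ħ u (Function.update mu 0 z) mu := by
    rw [← qFayMatrix_eq_alternantMatrix]
    exact det_qFayMatrix_of_forall_ne_zero_eq τ ħ u fun s hs => Function.update_of_ne hs z mu
  have := finiteDimensional_thetaSpace τ (u + ∑ r, mu r) n.succ_pos
  have hunique := (isAntisymmetric_qFayProduct τ ħ u mu).apply_mul_det_alternantMatrix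
    (by simpa using finrank_thetaSpace_le τ (u + ∑ r, mu r) n.succ_pos)
    (qFayProduct_update_zero_mem_thetaSpace ħ u hτ · mu) (qFayRow_mem_thetaSpace ħ u hτ mu)
    (hp.trans_ne hz) lam
  rw [hp, mul_comm, ← qFayMatrix_eq_alternantMatrix] at hunique
  exact (mul_left_cancel₀ hz hunique).symm

theorem eventually_qFayProduct_ne_zero (hτ : 0 < τ.im) {n : ℕ} (mu : Fin (n + 1) → ℂ) :
    ∀ᶠ t in 𝓝[≠] (0 : ℂ), qFayProduct τ (ħ - t) u
      (Function.update (fun r => mu r + t * (r : ℕ)) 0 (-t)) (fun r => mu r + t * (r : ℕ)) ≠ 0 := by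
  -- The direction is chosen so that the argument of every theta factor has nonzero slope in `t`.
  have hline {c : ℂ → ℂ} (a b : ℂ) (hb : b ≠ 0) (hc : ∀ t, c t = a + t * b) :
      ∀ᶠ t in 𝓝[≠] (0 : ℂ), theta τ (c t) ≠ 0 := by
    simpa only [hc] using eventually_theta_add_mul_ne_zero hτ a hb
  simp only [qFayProduct, mul_ne_zero_iff, Finset.prod_ne_zero_iff, eventually_and, eventually_all,
    Finset.eventually_all, Finset.mem_univ, Finset.mem_Ioi, true_imp_iff]
  refine ⟨⟨?_, fun s hs => ?_⟩, fun s s' hlt => ⟨?_, ?_⟩⟩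
  · refine hline (u + mu 0) 1 one_ne_zero fun t => ?_
    simp only [Fin.sum_univ_succ, Function.update_self,
      Function.update_of_ne (Fin.succ_ne_zero _), sub_self, Finset.sum_const_zero,
      Fin.val_zero, Nat.cast_zero]
    ring
  · have hslope : (s : ℂ) ≠ 0 :=
      Nat.cast_ne_zero.mpr (Nat.one_le_iff_ne_zero.mp (Finset.mem_Icc.mp hs).1)
    exact hline (u - s * ħ) s hslope fun t => by ring
  · simp only [Function.update_of_ne (Fin.ne_zero_of_lt hlt)]
    rcases eq_or_ne s 0 with rfl | hs
    · exact hline (mu s') (s' + 1) (Nat.cast_add_one_ne_zero _) fun t => by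
        rw [Function.update_self]
        ring
    · have hslope : ((s' : ℕ) - (s : ℕ) : ℂ) ≠ 0 :=
        sub_ne_zero.mpr (Nat.cast_injective.ne (Fin.val_injective.ne hlt.ne'))
      exact hline (mu s' - mu s) _ hslope fun t => by
        rw [Function.update_of_ne hs]
        ring
  · have hslope : ((s : ℕ) - ((s' + 1 : ℕ) : ℂ)) ≠ 0 :=
      sub_ne_zero.mpr (Nat.cast_injective.ne (Nat.lt_succ_of_lt hlt).ne)
    refine hline (ħ + mu s - mu s') _ hslope fun t => ?_
    push_cast
    ring

end QFay

section Continuity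

variable {τ : ℂ} {X : Type*} [TopologicalSpace X] {d : ℕ} {ħ u : X → ℂ} {lam mu : X → Fin d → ℂ}

theorem continuous_det_qFayMatrix (hτ : 0 < τ.im) (hħ : Continuous ħ)
    (hu : Continuous u) (hlam : Continuous lam) (hmu : Continuous mu) :
    Continuous fun t => (qFayMatrix τ (ħ t) (u t) (lam t) (mu t)).det := by
  have hθ := (differentiable_theta hτ).continuous
  refine Continuous.matrix_det (continuous_matrix fun s s' => ?_)
  simp only [qFayMatrix, Matrix.of_apply]
  fun_prop

theorem continuous_qFayProduct (hτ : 0 < τ.im) (hħ : Continuous ħ)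
    (hu : Continuous u) (hlam : Continuous lam) (hmu : Continuous mu) :
    Continuous fun t => qFayProduct τ (ħ t) (u t) (lam t) (mu t) := by
  have hθ := (differentiable_theta hτ).continuous
  unfold qFayProduct
  fun_prop

end Continuity

theorem lemma1 (τ : ℂ) (hτ : 0 < τ.im) (d : ℕ) (hd : 1 ≤ d) (ħ u : ℂ) (lam mu : Fin d → ℂ) :
    (qFayMatrix τ ħ u lam mu).det =
      theta τ (u + ∑ r : Fin d, (mu r - lam r)) *
        (∏ s ∈ Finset.Icc 1 (d - 1), theta τ (u - (s : ℂ) * ħ)) *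
        ∏ s : Fin d, ∏ s' ∈ Finset.Ioi s,
          (theta τ (lam s' - lam s) * theta τ (ħ + mu s - mu s')) := by
  obtain ⟨n, rfl⟩ := Nat.exists_eq_add_of_le' hd
  have hħ : Continuous fun t : ℂ => ħ - t := by fun_prop
  have hmu : Continuous fun (t : ℂ) (r : Fin (n + 1)) => mu r + t * (r : ℕ) := by fun_prop
  have hdet := continuous_det_qFayMatrix hτ hħ (continuous_const (y := u))
    (continuous_const (y := lam)) hmu
  have hprod := continuous_qFayProduct hτ hħ (continuous_const (y := u))
    (continuous_const (y := lam)) hmu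
  have hgeneric := (eventually_qFayProduct_ne_zero ħ u hτ mu).mono fun t ht =>
    det_qFayMatrix_eq_qFayProduct_of_ne_zero (ħ - t) u hτ lam ht
  have hlimit := tendsto_nhds_unique_of_eventuallyEq
    (hdet.tendsto 0 |>.mono_left nhdsWithin_le_nhds)
    (hprod.tendsto 0 |>.mono_left nhdsWithin_le_nhds) hgeneric
  simpa [qFayProduct] using hlimit
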